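/- For integers $k\ge 0$ and $j\ge 0$ let $$a_3(k,j)=\sum_{0\le i\le j,\ 3\nmid i}(-1)^i\binom ji i^k .$$ Let $\nu_3(x)$ denote the exponent of $3$ in the integer $x$ (with $\nu_3(0)=\infty$). For $n\ge1$ put $$e_3(k,n)=\min\{\nu_3(a_3(k,j)) : j\ge n\},\qquad s_3(n)=n-1+\nu_3(\lfloor n/3\rfloor !).$$ Let $T$ be the set of non-negative integers (including $0$) in whose base-$3$ expansion the sum of any two consecutive digits is less than $3$, and let $T'=\{m\in T: m\not\equiv 2 \pmod 3\}$. For a set $S$ of integers and integers $u,v$ write $uS+v=\{um+v : m\in S\}$. **Theorem.** Let $n\ge 1$ be an integer. Then $e_3(n-1,n)=s_3(n)$ if and only if $$n\in(3T+1)\cup(3T'+2)\cup(9T+3).$$ Moreover, if $n\in 9T+2$ (a subset of $3T'+2$), then $\nu_3(a_3(n-1,n+1))=s_3(n)$ while $\nu_3(a_3(n-1,n))>s_3(n)$; and for every other $n\in(3T+1)\cup(3T'+2)\cup(9T+3)$ one has $\nu_3(a_3(n-1,n))=s_3(n)$. -/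

import Mathlib

namespace PartialStirling

/-- The partial Stirling number
`a_p(k, j) = ∑_{i ≢ 0 (mod p)} (-1)^i (j choose i) i^k`; the terms with `i > j` vanish. -/
def a (p k j : ℕ) : ℤ :=
  ∑ i ∈ (Finset.range (j + 1)).filter (fun i => ¬ p ∣ i),
    (-1 : ℤ) ^ i * (j.choose i : ℤ) * (i : ℤ) ^ k

/-- The exponent `ν_p(x)` of `p` in an integer `x`, with `ν_p(0) = ∞`. -/
noncomputable def nu (p : ℕ) (x : ℤ) : ℕ∞ := emultiplicity (p : ℤ) x

/-- `e_p(k, n) = min {ν_p(a_p(k, j)) : j ≥ n}`. The infimum of a nonempty set in `ℕ∞` is attained. -/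
noncomputable def e (p k n : ℕ) : ℕ∞ := sInf {v | ∃ j, n ≤ j ∧ v = nu p (a p k j)}

/-- `s_p(n) = n - 1 + ν_p([n/p]!)`, used only for `n ≥ 1`. -/
def s (p n : ℕ) : ℕ := n - 1 + padicValNat p (Nat.factorial (n / p))

/-- The natural numbers (zero included) in whose base-3 expansion any two consecutive digits
have sum less than `3`. -/
def T : Set ℕ := {n | (Nat.digits 3 n).IsChain (fun x y => x + y < 3)}

/-- `T' = {n ∈ T : n ≢ 2 (mod 3)}`. -/
def T' : Set ℕ := {n | n ∈ T ∧ ¬ n ≡ 2 [MOD 3]}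

/-- `affine u S v` is the set `uS + v = {u m + v : m ∈ S}`. -/
def affine (u : ℕ) (S : Set ℕ) (v : ℕ) : Set ℕ := {n | ∃ m ∈ S, n = u * m + v}

end PartialStirling

/-!
For `k < j` the alternating sum of `(j choose i) i ^ k` over all `i` vanishes, so `a 3 k j` is
`-3 ^ k` times `B = ∑ₘ (-1)ᵐ (j choose 3m) mᵏ` (`a_eq_thirdSum`). Expanding `mᵏ` in the binomial
basis, `B = ∑_d S(k, d) d! c(d, j)` with `c(d, j) = ∑ₘ (-1)ᵐ (j choose 3m) (m choose d)`, and by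
Pascal's rule
`∑ⱼ c(d, j) Xʲ = (-1)ᵈ X ^ (3 d) (1 - X) ^ 2 / (1 - 3 X (1 - X)) ^ (d + 1)` (`mul_mk_chooseSum`).
The expansion in powers of `3 X (1 - X)` presents `d! c(d, j)` as a sum of integer multiples of
`(N + d)! 3 ^ N / N!`, and a comparison of degrees leaves only `N` with `⌊j/3⌋ ≤ N + d`. As
`3 ^ N / N!` is divisible by `3` for `N > 0`, this shows, with `q = ⌊j/3⌋`, that `B` agrees with
`(-1) ^ q q! S(k, q)` modulo one more power of `3` than divides `q!` (`pow_dvd_thirdSum_sub`).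

Hence `s₃(n)` is a lower bound for `ν₃(a₃(n - 1, j))` when `j ≥ n`, and it is attained exactly when
`⌊j/9⌋ = ⌊n/9⌋`, or equivalently `⌊j/3⌋!` and `⌊n/3⌋!` have the same valuation, and
`S(n - 1, ⌊j/3⌋)` is prime to `3` (`nu_a_of_ne_zero`, `of_nu_a_eq_s`). Modulo `3` the Stirling
numbers satisfy `S(n + 3, k + 3) = S(n + 1, k + 3) + S(n, k)`, which makes them zero or binomial
coefficients. If `⌊n/3⌋ ≤ q` and `⌊q/3⌋ = ⌊n/9⌋`, then `S(n - 1, q)` is a multiple of `3` or, up to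
a unit, `(m + ⌊m/3⌋ choose m)` with `m = ⌊n/3⌋`, or `m = 3 ⌊n/9⌋` in case `n ≡ 3 (mod 9)`. By Lucas'
theorem this binomial coefficient is prime to `3` if and only if `m ∈ T`
(`mem_T_iff_not_dvd_choose`).
-/

namespace PartialStirling

/-! ### Stirling numbers of the second kind modulo 3 -/

/-- The generating function `∑ S(n, k) x ^ n = x ^ k / ∏_{i ≤ k} (1 - i x)` acquires the factor
`x ^ 3 / (1 - x ^ 2)` modulo `3` when `k` increases by `3`. -/
theorem stirlingSecond_add_three (n k : ℕ) :
    (Nat.stirlingSecond (n + 3) (k + 3) : ZMod 3) =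
      Nat.stirlingSecond (n + 1) (k + 3) + Nat.stirlingSecond n k := by
  simp only [Nat.stirlingSecond_succ_succ]
  push_cast
  -- the identity holds for all values of the five residues that occur
  generalize (Nat.stirlingSecond n k : ZMod 3) = A
  generalize (Nat.stirlingSecond n (k + 1) : ZMod 3) = B
  generalize (Nat.stirlingSecond n (k + 2) : ZMod 3) = C
  generalize (Nat.stirlingSecond n (k + 3) : ZMod 3) = D
  generalize (k : ZMod 3) = x
  revert x A B C D
  decide

/-- A doubly indexed sequence with Pascal's recursion and all boundary values `1`
consists of binomial coefficients. -/
theorem eq_choose_of_pascal {R : Type*} [CommRing R] (g : ℕ → ℕ → R)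
    (h0 : ∀ c, g c 0 = 1) (h1 : ∀ w, g 0 w = 1)
    (hs : ∀ c w, g (c + 1) (w + 1) = g (c + 1) w + g c (w + 1)) (c w : ℕ) :
    g c w = ((c + w).choose w : ℕ) := by
  induction c generalizing w with
  | zero => simp [h1]
  | succ c ihc =>
    induction w with
    | zero => simp [h0]
    | succ w ihw =>
      rw [hs, ihw, ihc, show c + 1 + (w + 1) = (c + 1 + w) + 1 by ring, Nat.choose_succ_succ,
        show c + (w + 1) = c + 1 + w by ring]
      push_cast
      ring

theorem stirlingSecond_two_right (n : ℕ) : Nat.stirlingSecond (n + 2) 2 + 1 = 2 ^ (n + 1) := by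
  induction n with
  | zero => rfl
  | succ n ih =>
    rw [show n + 1 + 2 = (n + 2) + 1 by ring, show (2 : ℕ) = 1 + 1 by rfl,
      Nat.stirlingSecond_succ_succ, Nat.stirlingSecond_one_right]
    have : Nat.stirlingSecond (n + (1 + 1)) (1 + 1) + 1 = 2 ^ (n + 1) := ih
    rw [show (1 + 1 : ℕ) = 2 by rfl] at *
    rw [pow_succ 2 (n + 1)]
    omega

theorem two_pow_two_mul_zmod (w : ℕ) : (2 : ZMod 3) ^ (2 * w) = 1 := by
  rw [pow_mul, show (2 : ZMod 3) ^ 2 = 1 from rfl, one_pow]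

/-- `S(k + 1, k) = k (k + 1) / 2` is `1` modulo `3` for `k ≡ 1`. -/
theorem stirlingSecond_succ_one (c : ℕ) :
    (Nat.stirlingSecond (3 * c + 2) (3 * c + 1) : ZMod 3) = 1 := by
  have h3 : (3 : ZMod 3) = 0 := rfl
  have h : 2 * (3 * c + 2).choose 2 = (3 * c + 2) * (3 * c + 1) := by
    rw [Nat.choose_two_right, Nat.mul_div_cancel']
    · rfl
    · exact (Nat.even_mul_pred_self _).two_dvd
  rw [Nat.stirlingSecond_succ_self_left]
  have h' := congrArg (Nat.cast : ℕ → ZMod 3) h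
  push_cast at h'
  rw [h3] at h'
  linear_combination 2 * h' - ((3 * c + 2).choose 2 : ZMod 3) * h3 + h3

theorem stirlingSecond_succ_two (c : ℕ) :
    (Nat.stirlingSecond (3 * c + 3) (3 * c + 2) : ZMod 3) = 0 := by
  have h3 : (3 : ZMod 3) = 0 := rfl
  rw [show 3 * c + 3 = (3 * c + 2) + 1 by ring, Nat.stirlingSecond_succ_succ,
    Nat.stirlingSecond_self]
  push_cast
  rw [stirlingSecond_succ_one]
  linear_combination (c + 1 : ZMod 3) * h3

theorem stirlingSecond_one_even (c w : ℕ) :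
    (Nat.stirlingSecond (3 * c + 1 + 2 * w) (3 * c + 1) : ZMod 3) = ((c + w).choose w : ℕ) := by
  refine eq_choose_of_pascal
    (fun c w => (Nat.stirlingSecond (3 * c + 1 + 2 * w) (3 * c + 1) : ZMod 3)) ?_ ?_ ?_ c w
  · intro c; simp [Nat.stirlingSecond_self]
  · intro w
    rw [show 3 * 0 + 1 + 2 * w = 2 * w + 1 by ring, show 3 * 0 + 1 = 1 by rfl,
      Nat.stirlingSecond_one_right, Nat.cast_one]
  · intro c w
    convert stirlingSecond_add_three (3 * c + 1 + 2 * (w + 1)) (3 * c + 1) using 3 <;> ring_nf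

theorem stirlingSecond_one_odd (c w : ℕ) :
    (Nat.stirlingSecond (3 * c + 2 + 2 * w) (3 * c + 1) : ZMod 3) = ((c + w).choose w : ℕ) := by
  refine eq_choose_of_pascal
    (fun c w => (Nat.stirlingSecond (3 * c + 2 + 2 * w) (3 * c + 1) : ZMod 3)) ?_ ?_ ?_ c w
  · exact stirlingSecond_succ_one
  · intro w
    rw [show 3 * 0 + 2 + 2 * w = (2 * w + 1) + 1 by ring, show 3 * 0 + 1 = 1 by rfl,
      Nat.stirlingSecond_one_right, Nat.cast_one]
  · intro c w
    convert stirlingSecond_add_three (3 * c + 2 + 2 * (w + 1)) (3 * c + 1) using 3 <;> ring_nf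

theorem stirlingSecond_two_even (c w : ℕ) :
    (Nat.stirlingSecond (3 * c + 2 + 2 * w) (3 * c + 2) : ZMod 3) = ((c + w).choose w : ℕ) := by
  refine eq_choose_of_pascal
    (fun c w => (Nat.stirlingSecond (3 * c + 2 + 2 * w) (3 * c + 2) : ZMod 3)) ?_ ?_ ?_ c w
  · intro c; simp [Nat.stirlingSecond_self]
  · intro w
    have h := congrArg (Nat.cast : ℕ → ZMod 3) (stirlingSecond_two_right (2 * w))
    push_cast at h
    rw [pow_succ, two_pow_two_mul_zmod] at h
    rw [show 3 * 0 + 2 + 2 * w = 2 * w + 2 by ring, show 3 * 0 + 2 = 2 by rfl]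
    linear_combination h
  · intro c w
    convert stirlingSecond_add_three (3 * c + 2 + 2 * (w + 1)) (3 * c + 2) using 3 <;> ring_nf

theorem stirlingSecond_two_odd (c w : ℕ) :
    (Nat.stirlingSecond (3 * c + 3 + 2 * w) (3 * c + 2) : ZMod 3) = 0 := by
  induction c generalizing w with
  | zero =>
    have h := congrArg (Nat.cast : ℕ → ZMod 3) (stirlingSecond_two_right (2 * w + 1))
    push_cast at h
    rw [show 2 * w + 1 + 1 = 2 * (w + 1) by ring, two_pow_two_mul_zmod] at h
    rw [show 3 * 0 + 3 + 2 * w = 2 * w + 1 + 2 by ring, show 3 * 0 + 2 = 2 by rfl]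
    linear_combination h
  | succ c ihc =>
    induction w with
    | zero => exact stirlingSecond_succ_two (c + 1)
    | succ w ihw =>
      have h := stirlingSecond_add_three (3 * c + 3 + 2 * (w + 1)) (3 * c + 2)
      rw [ihc] at h
      rw [show 3 * (c + 1) + 3 + 2 * (w + 1) = 3 * c + 3 + 2 * (w + 1) + 3 by ring,
        show 3 * (c + 1) + 2 = 3 * c + 2 + 3 by ring, h, add_zero, ← ihw]
      congr 2
      ring

/-- The recursion loses its first term, as `3 c + 3 ≡ 0`. -/
theorem stirlingSecond_three (c v : ℕ) :
    (Nat.stirlingSecond (v + 1) (3 * c + 3) : ZMod 3) = Nat.stirlingSecond v (3 * c + 2) := by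
  have h3 : (3 : ZMod 3) = 0 := rfl
  rw [show 3 * c + 3 = (3 * c + 2) + 1 by ring, Nat.stirlingSecond_succ_succ]
  push_cast
  linear_combination ((c + 1) * (Nat.stirlingSecond v (3 * c + 2 + 1)) : ZMod 3) * h3

/-! ### Base-3 digits and binomial coefficients -/

theorem mem_T_iff (m : ℕ) : m ∈ T ↔ m % 3 + m / 3 % 3 < 3 ∧ m / 3 ∈ T := by
  unfold T
  simp only [Set.mem_ofPred_eq]
  rcases Nat.eq_zero_or_pos m with rfl | hm
  · simp
  · rw [Nat.digits_def' (by norm_num) hm]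
    rcases Nat.eq_zero_or_pos (m / 3) with h | h
    · simp [h, Nat.mod_lt]
    · rw [Nat.digits_def' (by norm_num) h]
      simp

/-- By Lucas' theorem: adding `m` and `m / 3` in base `3` produces no carry exactly when any
two consecutive digits of `m` have sum less than `3`. -/
theorem mem_T_iff_not_dvd_choose (m : ℕ) : m ∈ T ↔ ¬ 3 ∣ (m + m / 3).choose m := by
  induction m using Nat.strong_induction_on with
  | _ m ih =>
    rcases Nat.eq_zero_or_pos m with rfl | hm
    · simp [T]
    have : Fact (Nat.Prime 3) := ⟨Nat.prime_three⟩
    have hl := Choose.choose_modEq_choose_mod_mul_choose_div_nat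
      (n := m + m / 3) (k := m) (p := 3)
    rw [mem_T_iff, ih (m / 3) (by omega), hl.dvd_iff dvd_rfl, Nat.prime_three.dvd_mul, not_or]
    by_cases h : m % 3 + m / 3 % 3 < 3
    · have e1 : (m + m / 3) % 3 = m % 3 + m / 3 % 3 := by omega
      have e2 : (m + m / 3) / 3 = m / 3 + m / 3 / 3 := by omega
      have h4 : ¬ 3 ∣ ((m + m / 3) % 3).choose (m % 3) := by
        rw [e1]
        have := Nat.mod_lt m (show 0 < 3 by norm_num)
        have := Nat.mod_lt (m / 3) (show 0 < 3 by norm_num)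
        generalize m % 3 = x at *
        generalize m / 3 % 3 = y at *
        interval_cases x <;> interval_cases y <;> first | omega | decide
      simp only [h, h4, e2, true_and, not_false_eq_true]
    · have h4 : ((m + m / 3) % 3).choose (m % 3) = 0 := Nat.choose_eq_zero_of_lt (by omega)
      simp [h, h4]

section ThirdSum

open Finset PowerSeries

/-! ### Alternating sums over every third binomial coefficient -/

/-- The sum `∑ₘ (-1)ᵐ (j choose 3m) f(m)`; the terms with `3m > j` vanish. -/
def thirdSum (f : ℕ → ℤ) (j : ℕ) : ℤ :=
  ∑ m ∈ range (j + 1), (-1 : ℤ) ^ m * (j.choose (3 * m) : ℤ) * f m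

theorem thirdSum_eq (f : ℕ → ℤ) {j M : ℕ} (h : j < M) :
    thirdSum f j = ∑ m ∈ range M, (-1 : ℤ) ^ m * (j.choose (3 * m) : ℤ) * f m := by
  unfold thirdSum
  refine sum_subset (by intro x; simp; omega) ?_
  intro m _ hm
  rw [Nat.choose_eq_zero_of_lt (by simp at hm; omega)]
  simp

/-- As the full alternating sum vanishes for `k < j`, the partial Stirling number is minus the
sum over the multiples of `3`, from which `3 ^ k` can be extracted. -/
theorem a_eq_thirdSum {k j : ℕ} (h : k < j) :
    a 3 k j = -(3 ^ k * thirdSum (fun m => (m : ℤ) ^ k) j) := by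
  have hfull : ∑ i ∈ range (j + 1), (-1 : ℤ) ^ i * (j.choose i : ℤ) * (i : ℤ) ^ k = 0 := by
    have h1 := fwdDiff_iter_pow_eq_zero_of_lt (R := ℤ) h
    have h2 := congrFun h1 0
    rw [fwdDiff_iter_eq_sum_shift] at h2
    have h3 : ∑ i ∈ range (j + 1), (-1 : ℤ) ^ i * (j.choose i : ℤ) * (i : ℤ) ^ k =
        (-1) ^ j * ∑ i ∈ range (j + 1), ((-1 : ℤ) ^ (j - i) * (j.choose i : ℤ)) •
          (fun r : ℤ => r ^ k) (0 + i • (1 : ℤ)) := by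
      rw [mul_sum]
      refine sum_congr rfl fun i hi => ?_
      have hij : i ≤ j := by simp at hi; omega
      have : (-1 : ℤ) ^ j * (-1) ^ (j - i) = (-1) ^ i := by
        obtain ⟨l, rfl⟩ := Nat.exists_eq_add_of_le hij
        rw [Nat.add_sub_cancel_left, pow_add, mul_assoc, ← mul_pow]
        simp
      simp only [smul_eq_mul, nsmul_eq_mul, mul_one, zero_add]
      rw [← this]
      ring
    rw [h3, h2]
    simp
  rw [← sum_filter_add_sum_filter_not _ (fun i => 3 ∣ i)] at hfull
  have hthird : ∑ i ∈ (range (j + 1)).filter (fun i => 3 ∣ i),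
      (-1 : ℤ) ^ i * (j.choose i : ℤ) * (i : ℤ) ^ k =
      3 ^ k * thirdSum (fun m => (m : ℤ) ^ k) j := by
    rw [thirdSum, mul_sum]
    symm
    refine sum_bij_ne_zero (fun m _ _ => 3 * m) ?_ ?_ ?_ ?_
    · intro m _ hm
      have : 3 * m ≤ j := by
        by_contra hlt
        exact hm (by rw [Nat.choose_eq_zero_of_lt (by omega)]; simp)
      simp
      omega
    · intro m _ _ m' _ _ h
      omega
    · intro i hi hne
      simp only [mem_filter, mem_range] at hi
      obtain ⟨m, rfl⟩ := hi.2
      refine ⟨m, by simp; omega, ?_, rfl⟩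
      contrapose! hne
      rw [← hne]
      push_cast
      rw [pow_mul, mul_pow]
      norm_num
      ring
    · intro m _ _
      push_cast
      rw [pow_mul, mul_pow]
      norm_num
      ring
  rw [hthird] at hfull
  unfold a
  linarith

/-- Pascal's rule applied three times. -/
theorem thirdSum_add_three (f : ℕ → ℤ) (j : ℕ) :
    thirdSum f (j + 3) - 3 * thirdSum f (j + 2) + 3 * thirdSum f (j + 1) - thirdSum f j =
      -thirdSum (fun m => f (m + 1)) j := by
  rw [thirdSum_eq f (show j + 3 < j + 3 + 1 by omega),
    thirdSum_eq f (show j + 2 < j + 3 + 1 by omega),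
    thirdSum_eq f (show j + 1 < j + 3 + 1 by omega), thirdSum_eq f (show j < j + 3 + 1 by omega),
    thirdSum_eq _ (show j < j + 3 by omega), mul_sum, mul_sum, ← sum_sub_distrib,
    ← sum_add_distrib, ← sum_sub_distrib, sum_range_succ', ← sum_neg_distrib]
  simp only [mul_zero, Nat.choose_zero_right]
  have h0 : ∀ x : ℤ, (x - 3 * x + 3 * x - x) = 0 := fun x => by ring
  rw [h0, add_zero]
  refine sum_congr rfl fun m _ => ?_
  rw [show 3 * (m + 1) = 3 * m + 1 + 1 + 1 by ring]
  simp only [Nat.choose_succ_succ, Nat.succ_eq_add_one]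
  push_cast
  ring

/-- The alternating sum attached to the element `(· choose d)` of the binomial basis. -/
def chooseSum (d j : ℕ) : ℤ := thirdSum (fun m => (m.choose d : ℤ)) j

theorem thirdSum_add (f g : ℕ → ℤ) (j : ℕ) :
    thirdSum (fun m => f m + g m) j = thirdSum f j + thirdSum g j := by
  simp only [thirdSum, mul_add, sum_add_distrib]

theorem chooseSum_zero_add_three (j : ℕ) :
    chooseSum 0 (j + 3) - 3 * chooseSum 0 (j + 2) + 3 * chooseSum 0 (j + 1) = 0 := by
  have h := thirdSum_add_three (fun m => (m.choose 0 : ℤ)) j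
  simp only [Nat.choose_zero_right] at h
  simp only [chooseSum, Nat.choose_zero_right]
  linarith

theorem chooseSum_succ_add_three (d j : ℕ) :
    chooseSum (d + 1) (j + 3) - 3 * chooseSum (d + 1) (j + 2) + 3 * chooseSum (d + 1) (j + 1) =
      -chooseSum d j := by
  have h := thirdSum_add_three (fun m => (m.choose (d + 1) : ℤ)) j
  simp only [Nat.choose_succ_succ, Nat.succ_eq_add_one, Nat.cast_add, thirdSum_add] at h
  simp only [chooseSum]
  linarith

theorem chooseSum_of_lt_three {j : ℕ} (d : ℕ) (hj : j < 3) :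
    chooseSum d j = if d = 0 then 1 else 0 := by
  have h0 : chooseSum d j = (Nat.choose 0 d : ℤ) := by
    unfold chooseSum thirdSum
    rw [sum_range_succ']
    rw [sum_eq_zero]
    · simp
    · intro m _
      rw [Nat.choose_eq_zero_of_lt (by omega)]
      simp
  rw [h0]
  cases d <;> simp

theorem one_sub_mul_eq (F : PowerSeries ℤ) :
    (1 - 3 * X * (1 - X)) * F = F - X * (3 * F) + X * (X * (3 * F)) := by
  ring

theorem coeff_three_mul (n : ℕ) (F : PowerSeries ℤ) : coeff n (3 * F) = 3 * coeff n F :=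
  coeff_C_mul n F 3

theorem mul_mk_chooseSum_zero :
    (1 - 3 * X * (1 - X)) * PowerSeries.mk (chooseSum 0) = (1 - X) ^ 2 := by
  have hX : ((1 - X) ^ 2 : PowerSeries ℤ) = 1 - X - X + X ^ 2 := by ring
  rw [one_sub_mul_eq, hX]
  ext n
  rcases n with _ | _ | _ | n
  · simp [chooseSum_of_lt_three]
  · simp [chooseSum_of_lt_three, coeff_three_mul, coeff_succ_X_mul, coeff_X_pow, coeff_one]
  · simp [chooseSum_of_lt_three, coeff_three_mul, coeff_succ_X_mul, coeff_X_pow, coeff_one, coeff_X]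
  · have h := chooseSum_zero_add_three n
    simp [coeff_three_mul, coeff_succ_X_mul, coeff_X_pow, coeff_one, coeff_X]
    linarith

theorem mul_mk_chooseSum_succ (d : ℕ) :
    (1 - 3 * X * (1 - X)) * PowerSeries.mk (chooseSum (d + 1)) =
      -(X * (X * (X * PowerSeries.mk (chooseSum d)))) := by
  rw [one_sub_mul_eq]
  ext n
  rcases n with _ | _ | _ | n
  · simp [chooseSum_of_lt_three]
  · simp [chooseSum_of_lt_three, coeff_three_mul, coeff_succ_X_mul]
  · simp [chooseSum_of_lt_three, coeff_three_mul, coeff_succ_X_mul]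
  · have h := chooseSum_succ_add_three d n
    simp [coeff_three_mul, coeff_succ_X_mul]
    linarith

/-- The generating function of `chooseSum d`. -/
theorem mul_mk_chooseSum (d : ℕ) :
    (1 - 3 * X * (1 - X)) ^ (d + 1) * PowerSeries.mk (chooseSum d) =
      (-1) ^ d * X ^ (3 * d) * (1 - X) ^ 2 := by
  induction d with
  | zero => simpa using mul_mk_chooseSum_zero
  | succ d ih =>
    rw [pow_succ _ (d + 1), mul_assoc, mul_mk_chooseSum_succ]
    linear_combination (-X ^ 3) * ih

/-- The negative binomial series, truncated. -/
theorem one_sub_pow_mul_sum_choose {R : Type*} [CommRing R] (y : R) (d M : ℕ) :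
    ∃ r, (1 - y) ^ (d + 1) * ∑ N ∈ range M, ((N + d).choose d : R) * y ^ N = 1 + y ^ M * r := by
  induction d with
  | zero =>
    refine ⟨-1, ?_⟩
    have := mul_neg_geom_sum y M
    simp only [add_zero, Nat.choose_zero_right, Nat.cast_one, one_mul, zero_add, pow_one]
    rw [this]
    ring
  | succ d ih =>
    obtain ⟨r, hr⟩ := ih
    have h : (1 - y) * ∑ N ∈ range M, ((N + (d + 1)).choose (d + 1) : R) * y ^ N =
        ∑ N ∈ range M, ((N + d).choose d : R) * y ^ N - ((M + d).choose (d + 1) : R) * y ^ M := by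
      clear hr
      induction M with
      | zero => simp
      | succ M ihM =>
        rw [sum_range_succ, mul_add, ihM, sum_range_succ,
          show M + (d + 1) = M + d + 1 by ring, show M + 1 + d = M + d + 1 by ring,
          Nat.choose_succ_succ]
        push_cast
        ring
    refine ⟨r - (1 - y) ^ (d + 1) * ((M + d).choose (d + 1) : R), ?_⟩
    rw [pow_succ, mul_assoc, h, mul_sub, hr]
    ring

/-- Expanding the generating function in powers of `3 X (1 - X)`. -/
theorem chooseSum_eq (d j : ℕ) :
    chooseSum d j = ∑ N ∈ range (j + 1), ((-1) ^ d * ((N + d).choose d : ℤ) * 3 ^ N) *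
      coeff j (X ^ (3 * d + N) * (1 - X) ^ (N + 2) : PowerSeries ℤ) := by
  obtain ⟨r, hr⟩ := one_sub_pow_mul_sum_choose (3 * X * (1 - X) : PowerSeries ℤ) d (j + 1)
  have h := mul_mk_chooseSum d
  set F := PowerSeries.mk (chooseSum d) with hF
  have key : F = ∑ N ∈ range (j + 1), C ((-1) ^ d * ((N + d).choose d : ℤ) * 3 ^ N) *
      (X ^ (3 * d + N) * (1 - X) ^ (N + 2)) -
      X ^ (j + 1) * ((3 * (1 - X)) ^ (j + 1) * r * F) := by
    have e : ∑ N ∈ range (j + 1), C ((-1) ^ d * ((N + d).choose d : ℤ) * 3 ^ N) *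
        (X ^ (3 * d + N) * (1 - X) ^ (N + 2)) = (-1) ^ d * X ^ (3 * d) * (1 - X) ^ 2 *
        ∑ N ∈ range (j + 1), ((N + d).choose d : PowerSeries ℤ) * (3 * X * (1 - X)) ^ N := by
      rw [mul_sum]
      refine sum_congr rfl fun N _ => ?_
      rw [map_mul, map_mul, map_pow, map_pow, map_neg, map_one, map_natCast,
        show (C (3 : ℤ) : PowerSeries ℤ) = 3 from rfl, mul_pow, mul_pow]
      ring
    rw [e, ← h]
    have e2 : (3 * X * (1 - X) : PowerSeries ℤ) ^ (j + 1) =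
        X ^ (j + 1) * (3 * (1 - X)) ^ (j + 1) := by rw [← mul_pow]; ring
    rw [e2] at hr
    linear_combination (-F) * hr
  have hc := congrArg (coeff j) key
  rw [map_sub, map_sum, coeff_X_pow_mul', if_neg (by omega), sub_zero, hF, coeff_mk] at hc
  rw [hc]
  refine sum_congr rfl fun N _ => ?_
  rw [coeff_C_mul]

/-- `1 - X` to the power `n` is a polynomial of degree `n`. -/
theorem coeff_one_sub_X_pow_eq_zero {n l : ℕ} (h : n < l) :
    coeff l ((1 - X) ^ n : PowerSeries ℤ) = 0 := by
  have : ((1 - X) ^ n : PowerSeries ℤ) = ((1 - Polynomial.X) ^ n : Polynomial ℤ) := by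
    push_cast
    simp
  rw [this, Polynomial.coeff_coe]
  refine Polynomial.coeff_eq_zero_of_natDegree_lt (lt_of_le_of_lt ?_ h)
  refine (Polynomial.natDegree_pow_le).trans ?_
  have : (1 - Polynomial.X : Polynomial ℤ).natDegree ≤ 1 := by compute_degree
  nlinarith

/-- `m ^ k = ∑ S(k, d) m (m - 1) ⋯ (m - d + 1)`. -/
theorem pow_eq_sum_stirlingSecond (k m : ℕ) :
    (m : ℤ) ^ k =
      ∑ d ∈ range (k + 1), (Nat.stirlingSecond k d : ℤ) * (d.factorial * (m.choose d : ℤ)) := by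
  induction k with
  | zero => simp
  | succ k ih =>
    have hm : ∀ d : ℕ, (m : ℤ) * (d.factorial * (m.choose d : ℤ)) =
        (d + 1).factorial * (m.choose (d + 1) : ℤ) + d * (d.factorial * (m.choose d : ℤ)) := by
      intro d
      have h := Nat.choose_succ_right_eq m d
      rcases le_or_gt d m with hdm | hdm
      · zify [hdm] at h
        rw [Nat.factorial_succ]
        push_cast
        linear_combination (-(d.factorial : ℤ)) * h
      · rw [Nat.choose_eq_zero_of_lt hdm, Nat.choose_eq_zero_of_lt (by omega)]
        simp
    have h1 : ∑ d ∈ range (k + 1), (d : ℤ) * (Nat.stirlingSecond k d *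
          (d.factorial * (m.choose d : ℤ))) =
        ∑ d ∈ range (k + 1), ((d : ℤ) + 1) * (Nat.stirlingSecond k (d + 1) *
          ((d + 1).factorial * (m.choose (d + 1) : ℤ))) := by
      have := sum_range_succ' (fun d : ℕ => (d : ℤ) * (Nat.stirlingSecond k d *
          (d.factorial * (m.choose d : ℤ)))) (k + 1)
      rw [sum_range_succ, Nat.stirlingSecond_eq_zero_of_lt (Nat.lt_succ_self k)] at this
      simpa using this
    rw [pow_succ, ih, sum_range_succ' _ (k + 1), Nat.stirlingSecond_succ_zero, sum_mul]
    simp only [Nat.stirlingSecond_succ_succ]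
    have h2 : ∑ d ∈ range (k + 1), (Nat.stirlingSecond k d : ℤ) *
          (d.factorial * (m.choose d : ℤ)) * m =
        ∑ d ∈ range (k + 1), (Nat.stirlingSecond k d : ℤ) *
          ((d + 1).factorial * (m.choose (d + 1) : ℤ)) +
        ∑ d ∈ range (k + 1), (d : ℤ) * (Nat.stirlingSecond k d *
          (d.factorial * (m.choose d : ℤ))) := by
      rw [← sum_add_distrib]
      refine sum_congr rfl fun d _ => ?_
      linear_combination (Nat.stirlingSecond k d : ℤ) * hm d
    rw [h2, h1, ← sum_add_distrib]
    simp only [Nat.cast_zero, zero_mul, add_zero]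
    refine sum_congr rfl fun d _ => ?_
    push_cast
    ring

theorem thirdSum_pow (k j : ℕ) :
    thirdSum (fun m => (m : ℤ) ^ k) j =
      ∑ d ∈ range (k + 1), (Nat.stirlingSecond k d : ℤ) * (d.factorial * chooseSum d j) := by
  simp only [pow_eq_sum_stirlingSecond k, chooseSum, thirdSum, mul_sum]
  rw [sum_comm]
  refine sum_congr rfl fun d _ => sum_congr rfl fun m _ => ?_
  ring

/-! ### The sums modulo a power of 3 -/

/-- `ν₃(N!) < N` for `N > 0`, so that `3 ^ N / N!` is divisible by `3`. -/
theorem pow_dvd_factorial_quotient {q N d : ℕ} (hN : 0 < N) (hq : q ≤ N + d) :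
    3 ^ (padicValNat 3 q.factorial + 1) ∣ d.factorial * ((N + d).choose d * 3 ^ N) := by
  have : Fact (Nat.Prime 3) := ⟨Nat.prime_three⟩
  have hval : padicValNat 3 N.factorial < N := by
    have h := sub_one_mul_padicValNat_factorial (p := 3) N
    omega
  have hid : N.factorial * (d.factorial * (N + d).choose d) = (N + d).factorial := by
    have := Nat.add_choose_mul_factorial_mul_factorial N d
    rw [← this, ← Nat.choose_symm_add]
    ring
  have hpos : d.factorial * (N + d).choose d ≠ 0 :=
    mul_ne_zero d.factorial_ne_zero (Nat.choose_pos (by omega)).ne'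
  have hv := congrArg (padicValNat 3) hid
  rw [padicValNat.mul N.factorial_ne_zero hpos] at hv
  have hmono : padicValNat 3 q.factorial ≤ padicValNat 3 (N + d).factorial :=
    padicValNat_dvd_iff_le (Nat.factorial_ne_zero _) |>.1
      (pow_padicValNat_dvd.trans (Nat.factorial_dvd_factorial hq))
  rw [← mul_assoc]
  have hle : padicValNat 3 q.factorial + 1 ≤
      padicValNat 3 (d.factorial * (N + d).choose d) + N := by omega
  refine (pow_dvd_pow 3 hle).trans ?_
  rw [pow_add]
  exact mul_dvd_mul_right pow_padicValNat_dvd _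

/-- A term of `chooseSum_eq` with a nonzero coefficient has `j ≤ 3 d + 2 N + 2`, hence
`⌊j/3⌋ ≤ N + d` if `N > 0`. -/
theorem pow_dvd_factorial_mul_chooseSum_term {j d N : ℕ} (hN : 0 < N) :
    (3 : ℤ) ^ (padicValNat 3 (j / 3).factorial + 1) ∣
      d.factorial * (((-1) ^ d * ((N + d).choose d : ℤ) * 3 ^ N) *
        coeff j (X ^ (3 * d + N) * (1 - X) ^ (N + 2) : PowerSeries ℤ)) := by
  by_cases hj : j / 3 ≤ N + d
  · have h := pow_dvd_factorial_quotient hN hj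
    zify at h
    refine (h.mul_right ((-1) ^ d *
      coeff j (X ^ (3 * d + N) * (1 - X) ^ (N + 2) : PowerSeries ℤ))).trans (dvd_of_eq ?_)
    ring
  · rw [coeff_X_pow_mul']
    split_ifs with hle
    · -- here `j - (3 d + N) > N + 2`, the degree of the remaining factor
      rw [coeff_one_sub_X_pow_eq_zero (by omega)]
      simp
    · simp

/-- For `d ≠ ⌊j/3⌋` the term `N = 0` of `chooseSum_eq` vanishes too, as `(1 - X) ^ 2` has
degree `2`. -/
theorem pow_dvd_factorial_mul_chooseSum {j d : ℕ} (hd : d ≠ j / 3) :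
    (3 : ℤ) ^ (padicValNat 3 (j / 3).factorial + 1) ∣ d.factorial * chooseSum d j := by
  rw [chooseSum_eq, mul_sum]
  refine dvd_sum fun N _ => ?_
  rcases Nat.eq_zero_or_pos N with rfl | hN
  · rw [coeff_X_pow_mul']
    split_ifs with hle
    · rw [coeff_one_sub_X_pow_eq_zero (by omega)]
      simp
    · simp
  · exact pow_dvd_factorial_mul_chooseSum_term hN

/-- For `d = ⌊j/3⌋` only the term `N = 0` of `chooseSum_eq` survives the reduction, and the
coefficients `1, -2, 1` of `(1 - X) ^ 2` are all `1` modulo `3`. -/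
theorem pow_dvd_factorial_mul_chooseSum_sub (j : ℕ) :
    (3 : ℤ) ^ (padicValNat 3 (j / 3).factorial + 1) ∣
      (j / 3).factorial * chooseSum (j / 3) j - (-1) ^ (j / 3) * (j / 3).factorial := by
  rw [chooseSum_eq, sum_range_succ', mul_add, add_sub_assoc, mul_sum]
  refine dvd_add (dvd_sum fun N _ => pow_dvd_factorial_mul_chooseSum_term N.succ_pos) ?_
  have h3 : (3 : ℤ) ∣ coeff (j - 3 * (j / 3)) ((1 - X) ^ 2 : PowerSeries ℤ) - 1 := by
    have hX : ((1 - X) ^ 2 : PowerSeries ℤ) = 1 - X - X + X ^ 2 := by ring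
    rw [hX]
    have : j - 3 * (j / 3) < 3 := by omega
    interval_cases j - 3 * (j / 3) <;>
      simp [coeff_X_pow, coeff_one, coeff_X]
  rw [coeff_X_pow_mul', if_pos (by omega)]
  have hf : (3 : ℤ) ^ padicValNat 3 (j / 3).factorial ∣ (j / 3).factorial := by
    exact_mod_cast (pow_padicValNat_dvd (p := 3) (n := (j / 3).factorial))
  rw [pow_succ]
  refine ((mul_dvd_mul hf h3).mul_left ((-1) ^ (j / 3))).trans (dvd_of_eq ?_)
  simp
  ring

/-- The sum of `(-1)ᵐ (j choose 3m) mᵏ` agrees with `± q! S(k, q)`, where `q = ⌊j/3⌋`, modulo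
one more power of `3` than divides `q!`. -/
theorem pow_dvd_thirdSum_sub (k j : ℕ) :
    (3 : ℤ) ^ (padicValNat 3 (j / 3).factorial + 1) ∣
      thirdSum (fun m => (m : ℤ) ^ k) j -
        (-1) ^ (j / 3) * ((j / 3).factorial * Nat.stirlingSecond k (j / 3)) := by
  rw [thirdSum_pow]
  by_cases hq : j / 3 ∈ range (k + 1)
  · rw [← add_sum_erase _ _ hq, add_sub_right_comm]
    refine dvd_add ?_ (dvd_sum fun d hd => ?_)
    · refine ((pow_dvd_factorial_mul_chooseSum_sub j).mul_left
        (Nat.stirlingSecond k (j / 3) : ℤ)).trans (dvd_of_eq ?_)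
      ring
    · exact (pow_dvd_factorial_mul_chooseSum (ne_of_mem_erase hd)).mul_left _
  · rw [Nat.stirlingSecond_eq_zero_of_lt (by simpa using hq)]
    simp only [Nat.cast_zero, mul_zero, sub_zero]
    refine dvd_sum fun d hd => (pow_dvd_factorial_mul_chooseSum ?_).mul_left _
    rintro rfl
    exact hq hd

end ThirdSum

/-! ### Nonvanishing of the relevant Stirling numbers modulo 3 -/

theorem choose_ne_zero_iff_mem_T (c : ℕ) {i : ℕ} (hi : i < 3) :
    (((c + (3 * c + i)).choose (3 * c + i) : ℕ) : ZMod 3) ≠ 0 ↔ 3 * c + i ∈ T := by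
  rw [mem_T_iff_not_dvd_choose, show 3 * c + i + (3 * c + i) / 3 = c + (3 * c + i) by omega, ne_eq,
    ZMod.natCast_eq_zero_iff]

theorem three_mul_mem_T_iff (c : ℕ) : 3 * c ∈ T ↔ c ∈ T := by
  rw [mem_T_iff, show 3 * c % 3 + 3 * c / 3 % 3 = c % 3 by omega, show 3 * c / 3 = c by omega,
    and_iff_right (Nat.mod_lt _ (by norm_num))]

theorem choose_four_mul_add_three (c : ℕ) :
    (4 * c + 3).choose (3 * c + 2) = 3 * (4 * c + 3).choose (3 * c + 3) := by
  have h := Nat.choose_succ_right_eq (4 * c + 3) (3 * c + 2)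
  rw [show 4 * c + 3 - (3 * c + 2) = c + 1 by omega] at h
  have : 0 < c + 1 := c.succ_pos
  nlinarith

theorem choose_four_mul_add_four (c : ℕ) :
    (4 * c + 4).choose (3 * c + 3) = 4 * (4 * c + 3).choose (3 * c + 3) := by
  have h := choose_four_mul_add_three c
  rw [show 4 * c + 4 = (4 * c + 3) + 1 by ring, show 3 * c + 3 = (3 * c + 2) + 1 by ring,
    Nat.choose_succ_succ, h]
  ring

/-- The case `n ≡ 1 (mod 9)`, where `(4c choose 3c) = 4 (4c - 1 choose 3c)`. -/
theorem stirlingSecond_nine_mul_ne_zero_iff (c : ℕ) :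
    (Nat.stirlingSecond (9 * c) (3 * c) : ZMod 3) ≠ 0 ↔ 3 * c ∈ T := by
  rcases c with _ | c
  · simp [T]
  · have h := choose_ne_zero_iff_mem_T (c + 1) (show 0 < 3 by norm_num)
    have e := stirlingSecond_two_even c (3 * c + 3)
    rw [← stirlingSecond_three, show c + (3 * c + 3) = 4 * c + 3 by ring] at e
    rw [show c + 1 + (3 * (c + 1) + 0) = 4 * c + 4 by ring,
      show 3 * (c + 1) + 0 = 3 * c + 3 by ring, choose_four_mul_add_four] at h
    rw [show 9 * (c + 1) = 3 * c + 2 + 2 * (3 * c + 3) + 1 by ring,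
      show 3 * (c + 1) = 3 * c + 3 by ring, e, ← h]
    push_cast
    rw [show (4 : ZMod 3) = 1 from rfl, one_mul]

/-- The vanishing of `(4 d - 1 choose 3 d - 1)` modulo `3`, for `d = c + 1`. -/
theorem choose_eq_zero_zmod (c : ℕ) :
    ((((c + 1) + (3 * c + 2)).choose (3 * c + 2) : ℕ) : ZMod 3) = 0 := by
  rw [show c + 1 + (3 * c + 2) = 4 * c + 3 by ring, choose_four_mul_add_three,
    ZMod.natCast_eq_zero_iff]
  exact dvd_mul_right _ _

/-- If `S(n - 1, q)` is prime to `3` for some `q ≥ ⌊n/3⌋` with the same quotient by `3`,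
then `n` satisfies the digit condition. The proof evaluates `S(n - 1, 3 c + r)` for each residue
of `n = 9 c + ρ` modulo `9` and each `r < 3`. -/
theorem digits_of_stirlingSecond_ne_zero {n q : ℕ} (hn : 1 ≤ n) (hq : n / 3 ≤ q)
    (hq' : q / 3 = n / 9) (hS : (Nat.stirlingSecond (n - 1) q : ZMod 3) ≠ 0) :
    (n % 3 = 1 ∧ n / 3 ∈ T) ∨ (n % 3 = 2 ∧ n / 3 % 3 ≠ 2 ∧ n / 3 ∈ T) ∨
      (n % 9 = 3 ∧ n / 9 ∈ T) := by
  obtain ⟨c, ρ, hρ, rfl⟩ : ∃ c ρ, ρ < 9 ∧ n = 9 * c + ρ := ⟨n / 9, n % 9, by omega, by omega⟩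
  obtain ⟨r, hr, rfl⟩ : ∃ r, r < 3 ∧ q = 3 * c + r := ⟨q - 3 * c, by omega, by omega⟩
  have hc : ∀ i < 9, (9 * c + i) / 9 = c := by omega
  have h30 : ∀ i < 3, (9 * c + i) / 3 = 3 * c := by omega
  have h31 : ∀ i, 3 ≤ i → i < 6 → (9 * c + i) / 3 = 3 * c + 1 := by omega
  have h32 : ∀ i, 6 ≤ i → i < 9 → (9 * c + i) / 3 = 3 * c + 2 := by omega
  interval_cases ρ
  · exfalso
    -- `c > 0` as `n > 0`
    obtain ⟨c, rfl⟩ : ∃ d, c = d + 1 := ⟨c - 1, by omega⟩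
    rw [show 9 * (c + 1) + 0 - 1 = 9 * c + 8 by omega] at hS
    interval_cases r
    · have h := stirlingSecond_two_odd c (3 * c + 2)
      rw [← stirlingSecond_three] at h
      exact hS (by convert h using 3 <;> omega)
    · have h := stirlingSecond_one_even (c + 1) (3 * c + 2)
      rw [choose_eq_zero_zmod] at h
      exact hS (by convert h using 3 <;> omega)
    · have h := stirlingSecond_two_odd (c + 1) (3 * c + 1)
      exact hS (by convert h using 3 <;> omega)
  · refine Or.inl ⟨by omega, ?_⟩
    rw [h30 1 (by norm_num)]
    rw [Nat.add_sub_cancel] at hS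
    rcases c with _ | c
    · simp [T]
    · interval_cases r
      · exact (stirlingSecond_nine_mul_ne_zero_iff (c + 1)).1 hS
      · have h := stirlingSecond_one_odd (c + 1) (3 * c + 2)
        rw [choose_eq_zero_zmod] at h
        exact absurd (by convert h using 3; ring) hS
      · have h := stirlingSecond_two_even (c + 1) (3 * c + 2)
        rw [choose_eq_zero_zmod] at h
        exact absurd (by convert h using 3; ring) hS
  · refine Or.inr (Or.inl ⟨by omega, by omega, ?_⟩)
    rw [h30 2 (by norm_num)]
    interval_cases r
    · rcases c with _ | c
      · simp [T]
      · have h := stirlingSecond_two_odd c (3 * c + 3)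
        rw [← stirlingSecond_three] at h
        exact absurd (by convert h using 3 <;> omega) hS
    · rw [← add_zero (3 * c), ← choose_ne_zero_iff_mem_T c (by norm_num),
        ← stirlingSecond_one_even]
      convert hS using 3; omega
    · rcases c with _ | c
      · simp [T]
      · have h := stirlingSecond_two_odd (c + 1) (3 * c + 2)
        exact absurd (by convert h using 3 <;> omega) hS
  · refine Or.inr (Or.inr ⟨by omega, ?_⟩)
    rw [hc 3 (by norm_num), ← three_mul_mem_T_iff, ← add_zero (3 * c),
      ← choose_ne_zero_iff_mem_T c (by norm_num)]
    interval_cases r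
    · omega
    · rw [← stirlingSecond_one_odd]
      convert hS using 3; omega
    · rw [← stirlingSecond_two_even]
      convert hS using 3; omega
  · refine Or.inl ⟨by omega, ?_⟩
    rw [h31 4 (by norm_num) (by norm_num), ← choose_ne_zero_iff_mem_T c (by norm_num)]
    interval_cases r
    · omega
    · rw [← stirlingSecond_one_even]
      convert hS using 3; omega
    · have h := stirlingSecond_two_odd c (3 * c)
      exact absurd (by convert h using 3 <;> omega) hS
  · refine Or.inr (Or.inl ⟨by omega, by omega, ?_⟩)
    rw [h31 5 (by norm_num) (by norm_num), ← choose_ne_zero_iff_mem_T c (by norm_num)]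
    interval_cases r
    · omega
    · rw [← stirlingSecond_one_odd]
      convert hS using 3; omega
    · rw [← stirlingSecond_two_even]
      convert hS using 3; omega
  · obtain rfl : r = 2 := by omega
    have h := stirlingSecond_two_odd c (3 * c + 1)
    exact absurd (by convert h using 3 <;> omega) hS
  · obtain rfl : r = 2 := by omega
    refine Or.inl ⟨by omega, ?_⟩
    rw [h32 7 (by norm_num) (by norm_num), ← choose_ne_zero_iff_mem_T c (by norm_num),
      ← stirlingSecond_two_even]
    convert hS using 3; omega
  · obtain rfl : r = 2 := by omega
    have h := stirlingSecond_two_odd c (3 * c + 2)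
    exact absurd (by convert h using 3 <;> omega) hS

theorem stirlingSecond_ne_zero_of_digits {n : ℕ} (h2 : n % 9 ≠ 2)
    (h : (n % 3 = 1 ∧ n / 3 ∈ T) ∨ (n % 3 = 2 ∧ n / 3 % 3 ≠ 2 ∧ n / 3 ∈ T) ∨
      (n % 9 = 3 ∧ n / 9 ∈ T)) :
    (Nat.stirlingSecond (n - 1) (n / 3) : ZMod 3) ≠ 0 := by
  have hcases : n % 9 = 1 ∨ n % 9 = 3 ∨ n % 9 = 4 ∨ n % 9 = 5 ∨ n % 9 = 7 := by omega
  obtain ⟨c, hc⟩ : ∃ c, c = n / 9 := ⟨_, rfl⟩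
  rcases hcases with h9 | h9 | h9 | h9 | h9
  · have hT : n / 3 ∈ T := by
      rcases h with ⟨-, h⟩ | ⟨-, -, h⟩ | ⟨h, -⟩ <;> first | exact h | omega
    rw [show n / 3 = 3 * c by omega] at hT ⊢
    rw [show n - 1 = 9 * c by omega]
    exact (stirlingSecond_nine_mul_ne_zero_iff c).2 hT
  · have hT : n / 9 ∈ T := by
      rcases h with ⟨h, -⟩ | ⟨h, -⟩ | ⟨-, h⟩ <;> first | exact h | omega
    rw [← hc, ← three_mul_mem_T_iff, ← add_zero (3 * c),
      ← choose_ne_zero_iff_mem_T c (by norm_num), ← stirlingSecond_one_odd] at hT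
    convert hT using 3 <;> omega
  · have hT : n / 3 ∈ T := by
      rcases h with ⟨-, h⟩ | ⟨-, -, h⟩ | ⟨h, -⟩ <;> first | exact h | omega
    rw [show n / 3 = 3 * c + 1 by omega, ← choose_ne_zero_iff_mem_T c (by norm_num),
      ← stirlingSecond_one_even] at hT
    convert hT using 3 <;> omega
  · have hT : n / 3 ∈ T := by
      rcases h with ⟨-, h⟩ | ⟨-, -, h⟩ | ⟨h, -⟩ <;> first | exact h | omega
    rw [show n / 3 = 3 * c + 1 by omega, ← choose_ne_zero_iff_mem_T c (by norm_num),
      ← stirlingSecond_one_odd] at hT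
    convert hT using 3 <;> omega
  · have hT : n / 3 ∈ T := by
      rcases h with ⟨-, h⟩ | ⟨-, -, h⟩ | ⟨h, -⟩ <;> first | exact h | omega
    rw [show n / 3 = 3 * c + 2 by omega, ← choose_ne_zero_iff_mem_T c (by norm_num),
      ← stirlingSecond_two_even] at hT
    convert hT using 3 <;> omega

theorem stirlingSecond_nine_mul_add_two (c : ℕ) :
    (Nat.stirlingSecond (9 * c + 1) (3 * c) : ZMod 3) = 0 := by
  rcases c with _ | c
  · simp
  · have h := stirlingSecond_two_odd c (3 * c + 3)
    rw [← stirlingSecond_three] at h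
    convert h using 3 <;> omega

theorem stirlingSecond_nine_mul_add_two_ne_zero {c : ℕ} (hc : c ∈ T) :
    (Nat.stirlingSecond (9 * c + 1) (3 * c + 1) : ZMod 3) ≠ 0 := by
  rw [← three_mul_mem_T_iff, ← add_zero (3 * c),
    ← choose_ne_zero_iff_mem_T c (by norm_num), ← stirlingSecond_one_even] at hc
  convert hc using 3; omega

/-! ### Valuations of the partial Stirling numbers -/

/-- `q!` gains a factor `3` whenever `q` passes a multiple of `3`. -/
theorem padicValNat_factorial_lt {p q : ℕ} (h : p / 3 < q / 3) :
    padicValNat 3 p.factorial < padicValNat 3 q.factorial := by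
  have : Fact (Nat.Prime 3) := ⟨Nat.prime_three⟩
  rw [Nat.lt_iff_add_one_le, ← padicValNat_dvd_iff_le q.factorial_ne_zero, pow_succ]
  have h1 : 3 * (p / 3) + 3 ≤ q := by omega
  refine dvd_trans ?_ (Nat.factorial_dvd_factorial h1)
  rw [show 3 * (p / 3) + 3 = (3 * (p / 3) + 2) + 1 by ring, Nat.factorial_succ, mul_comm]
  exact mul_dvd_mul ⟨p / 3 + 1, by ring⟩
    (pow_padicValNat_dvd.trans (Nat.factorial_dvd_factorial (by omega)))

theorem padicValNat_factorial_mono {p q : ℕ} (h : p ≤ q) :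
    padicValNat 3 p.factorial ≤ padicValNat 3 q.factorial := by
  have : Fact (Nat.Prime 3) := ⟨Nat.prime_three⟩
  exact (padicValNat_dvd_iff_le q.factorial_ne_zero).1
    (pow_padicValNat_dvd.trans (Nat.factorial_dvd_factorial h))

/-- Write `3 ^ v` for the power of `3` in `⌊j/3⌋!`. Then `a₃(k, j)` is `3 ^ (k + v)` times an
integer that is prime to `3` exactly when `S(k, ⌊j/3⌋)` is. -/
theorem exists_a_eq {k j : ℕ} (h : k < j) :
    ∃ y : ℤ, a 3 k j = 3 ^ (k + padicValNat 3 (j / 3).factorial) * y ∧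
      (3 ∣ y ↔ (Nat.stirlingSecond k (j / 3) : ZMod 3) = 0) := by
  have : Fact (Nat.Prime 3) := ⟨Nat.prime_three⟩
  obtain ⟨t, ht⟩ := pow_dvd_thirdSum_sub k j
  obtain ⟨u, hu⟩ := pow_padicValNat_dvd (p := 3) (n := (j / 3).factorial)
  set v := padicValNat 3 (j / 3).factorial with hv
  have hu3 : ¬ 3 ∣ u := by
    rintro ⟨w, rfl⟩
    exact pow_succ_padicValNat_not_dvd (p := 3) (j / 3).factorial_ne_zero
      ⟨w, by rw [← hv, pow_succ, mul_assoc]; exact hu⟩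
  have hu' : ((j / 3).factorial : ℤ) = 3 ^ v * u := by exact_mod_cast hu
  refine ⟨-(3 * t + (-1) ^ (j / 3) * ((u * Nat.stirlingSecond k (j / 3) : ℕ) : ℤ)), ?_, ?_⟩
  · rw [a_eq_thirdSum h, sub_eq_iff_eq_add.1 ht, hu']
    push_cast
    ring
  · rw [dvd_neg, dvd_add_right (dvd_mul_right 3 t),
      (isUnit_one.neg.pow (j / 3)).dvd_mul_left, ZMod.natCast_eq_zero_iff]
    norm_cast
    rw [Nat.prime_three.dvd_mul, or_iff_right hu3]

theorem nu_a_of_ne_zero {k j : ℕ} (h : k < j)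
    (hS : (Nat.stirlingSecond k (j / 3) : ZMod 3) ≠ 0) :
    nu 3 (a 3 k j) = (k + padicValNat 3 (j / 3).factorial : ℕ) := by
  obtain ⟨y, hy, hiff⟩ := exists_a_eq h
  rw [nu, emultiplicity_eq_coe, hy]
  refine ⟨dvd_mul_right _ _, fun hdvd => hS (hiff.1 ?_)⟩
  rw [pow_succ] at hdvd
  exact (mul_dvd_mul_iff_left (by positivity)).1 hdvd

theorem lt_nu_a_of_eq_zero {k j : ℕ} (h : k < j)
    (hS : (Nat.stirlingSecond k (j / 3) : ZMod 3) = 0) :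
    ((k + padicValNat 3 (j / 3).factorial : ℕ) : ℕ∞) < nu 3 (a 3 k j) := by
  obtain ⟨y, hy, hiff⟩ := exists_a_eq h
  refine lt_of_lt_of_le (b := ((k + padicValNat 3 (j / 3).factorial + 1 : ℕ) : ℕ∞))
    (by exact_mod_cast Nat.lt_succ_self _) ?_
  refine le_emultiplicity_of_pow_dvd ?_
  rw [hy, pow_succ]
  exact mul_dvd_mul_left _ (hiff.2 hS)

theorem s_le_nu_a {n j : ℕ} (hn : 1 ≤ n) (hj : n ≤ j) : (s 3 n : ℕ∞) ≤ nu 3 (a 3 (n - 1) j) := by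
  have h1 : (s 3 n : ℕ∞) ≤ ((n - 1 + padicValNat 3 (j / 3).factorial : ℕ) : ℕ∞) := by
    have := padicValNat_factorial_mono (Nat.div_le_div_right (c := 3) hj)
    exact_mod_cast Nat.add_le_add_left this (n - 1)
  by_cases hS : (Nat.stirlingSecond (n - 1) (j / 3) : ZMod 3) = 0
  · exact h1.trans (lt_nu_a_of_eq_zero (by omega) hS).le
  · exact h1.trans (nu_a_of_ne_zero (by omega) hS).ge

/-- The minimum defining `e₃(n - 1, n)` reaches its lower bound `s₃(n)` only at an index `j` with
`⌊j/9⌋ = ⌊n/9⌋`. -/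
theorem of_nu_a_eq_s {n j : ℕ} (hn : 1 ≤ n) (hj : n ≤ j)
    (h : nu 3 (a 3 (n - 1) j) = (s 3 n : ℕ∞)) :
    j / 3 / 3 = n / 9 ∧ (Nat.stirlingSecond (n - 1) (j / 3) : ZMod 3) ≠ 0 := by
  have hmono := padicValNat_factorial_mono (Nat.div_le_div_right (c := 3) hj)
  have hS : (Nat.stirlingSecond (n - 1) (j / 3) : ZMod 3) ≠ 0 := by
    intro hS
    have h1 := lt_nu_a_of_eq_zero (show n - 1 < j by omega) hS
    rw [h, s] at h1
    have : n - 1 + padicValNat 3 (j / 3).factorial <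
      n - 1 + padicValNat 3 (n / 3).factorial := by exact_mod_cast h1
    omega
  refine ⟨?_, hS⟩
  rw [nu_a_of_ne_zero (by omega) hS, s] at h
  have h2 : n - 1 + padicValNat 3 (j / 3).factorial =
    n - 1 + padicValNat 3 (n / 3).factorial := by exact_mod_cast h
  by_contra hne
  have := padicValNat_factorial_lt (show n / 3 / 3 < j / 3 / 3 by omega)
  omega

theorem e_eq_s_iff {n : ℕ} (hn : 1 ≤ n) :
    e 3 (n - 1) n = (s 3 n : ℕ∞) ↔ ∃ j, n ≤ j ∧ nu 3 (a 3 (n - 1) j) = (s 3 n : ℕ∞) := by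
  have hlb : (s 3 n : ℕ∞) ≤ e 3 (n - 1) n := by
    refine le_sInf ?_
    rintro v ⟨j, hj, rfl⟩
    exact s_le_nu_a hn hj
  constructor
  · intro h
    have hmem : e 3 (n - 1) n ∈ {v | ∃ j, n ≤ j ∧ v = nu 3 (a 3 (n - 1) j)} :=
      csInf_mem ⟨_, n, le_rfl, rfl⟩
    obtain ⟨j, hj, hv⟩ := hmem
    exact ⟨j, hj, hv.symm.trans h⟩
  · rintro ⟨j, hj, hv⟩
    exact le_antisymm (sInf_le ⟨j, hj, hv.symm⟩) hlb

theorem mem_affine_iff (S : Set ℕ) {u v : ℕ} (hv : v < u) (n : ℕ) :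
    n ∈ affine u S v ↔ n % u = v ∧ n / u ∈ S := by
  constructor
  · rintro ⟨m, hm, rfl⟩
    rw [Nat.mul_add_mod, Nat.mod_eq_of_lt hv, Nat.mul_add_div (by omega), Nat.div_eq_of_lt hv]
    exact ⟨rfl, hm⟩
  · rintro ⟨h1, h2⟩
    exact ⟨n / u, h2, by rw [← h1, Nat.div_add_mod]⟩

theorem mem_union_iff (n : ℕ) :
    n ∈ affine 3 T 1 ∪ affine 3 T' 2 ∪ affine 9 T 3 ↔
      (n % 3 = 1 ∧ n / 3 ∈ T) ∨ (n % 3 = 2 ∧ n / 3 % 3 ≠ 2 ∧ n / 3 ∈ T) ∨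
        (n % 9 = 3 ∧ n / 9 ∈ T) := by
  rw [Set.mem_union, Set.mem_union, mem_affine_iff _ (by norm_num),
    mem_affine_iff _ (by norm_num), mem_affine_iff _ (by norm_num), or_assoc,
    show n / 3 ∈ T' ↔ n / 3 % 3 ≠ 2 ∧ n / 3 ∈ T from and_comm]

theorem nu_a_self_eq_s {n : ℕ} (hn : 1 ≤ n)
    (hS : (Nat.stirlingSecond (n - 1) (n / 3) : ZMod 3) ≠ 0) :
    nu 3 (a 3 (n - 1) n) = (s 3 n : ℕ∞) :=
  nu_a_of_ne_zero (by omega) hS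

/-- For `n = 9 c + 2` the quotients `⌊n/3⌋ = 3 c` and `⌊(n + 1)/3⌋ = 3 c + 1` have factorials
of the same valuation, and of `S(n - 1, 3 c)` and `S(n - 1, 3 c + 1)` only the latter is prime
to `3`. -/
theorem nu_a_nine_mul_add_two {c : ℕ} (hc : c ∈ T) :
    nu 3 (a 3 (9 * c + 2 - 1) (9 * c + 2 + 1)) = (s 3 (9 * c + 2) : ℕ∞) ∧
      (s 3 (9 * c + 2) : ℕ∞) < nu 3 (a 3 (9 * c + 2 - 1) (9 * c + 2)) := by
  have : Fact (Nat.Prime 3) := ⟨Nat.prime_three⟩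
  have h1 : (9 * c + 2 + 1) / 3 = 3 * c + 1 := by omega
  have h2 : (9 * c + 2) / 3 = 3 * c := by omega
  constructor
  · rw [nu_a_of_ne_zero (by omega)
      (by rw [h1]; exact stirlingSecond_nine_mul_add_two_ne_zero hc), s, h1, h2,
      Nat.factorial_succ, padicValNat.mul (by omega) (Nat.factorial_ne_zero _),
      padicValNat.eq_zero_of_not_dvd (show ¬ 3 ∣ 3 * c + 1 by omega), zero_add]
  · exact lt_nu_a_of_eq_zero (by omega) (by rw [h2]; exact stirlingSecond_nine_mul_add_two c)

end PartialStirling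

theorem theorem1p4 (n : ℕ) (hn : 1 ≤ n) :
    (PartialStirling.e 3 (n - 1) n = (PartialStirling.s 3 n : ℕ∞) ↔
      n ∈ PartialStirling.affine 3 PartialStirling.T 1 ∪
          PartialStirling.affine 3 PartialStirling.T' 2 ∪
          PartialStirling.affine 9 PartialStirling.T 3) ∧
    (n ∈ PartialStirling.affine 9 PartialStirling.T 2 →
      PartialStirling.nu 3 (PartialStirling.a 3 (n - 1) (n + 1)) = (PartialStirling.s 3 n : ℕ∞) ∧
      (PartialStirling.s 3 n : ℕ∞) < PartialStirling.nu 3 (PartialStirling.a 3 (n - 1) n)) ∧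
    (n ∈ PartialStirling.affine 3 PartialStirling.T 1 ∪
          PartialStirling.affine 3 PartialStirling.T' 2 ∪
          PartialStirling.affine 9 PartialStirling.T 3 →
      n ∉ PartialStirling.affine 9 PartialStirling.T 2 →
      PartialStirling.nu 3 (PartialStirling.a 3 (n - 1) n) = (PartialStirling.s 3 n : ℕ∞)) := by
  have hfirst : n ∈ PartialStirling.affine 9 PartialStirling.T 2 →
      PartialStirling.nu 3 (PartialStirling.a 3 (n - 1) (n + 1)) = (PartialStirling.s 3 n : ℕ∞) ∧
      (PartialStirling.s 3 n : ℕ∞) < PartialStirling.nu 3 (PartialStirling.a 3 (n - 1) n) := by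
    rintro ⟨c, hc, rfl⟩
    exact PartialStirling.nu_a_nine_mul_add_two hc
  have hother : n ∈ PartialStirling.affine 3 PartialStirling.T 1 ∪
          PartialStirling.affine 3 PartialStirling.T' 2 ∪
          PartialStirling.affine 9 PartialStirling.T 3 →
      n ∉ PartialStirling.affine 9 PartialStirling.T 2 →
      PartialStirling.nu 3 (PartialStirling.a 3 (n - 1) n) = (PartialStirling.s 3 n : ℕ∞) := by
    intro hmem hnot
    rw [PartialStirling.mem_union_iff] at hmem
    rw [PartialStirling.mem_affine_iff _ (by norm_num)] at hnot
    refine PartialStirling.nu_a_self_eq_s hn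
      (PartialStirling.stirlingSecond_ne_zero_of_digits (fun h2 => hnot ⟨h2, ?_⟩) hmem)
    -- dropping the last digit of `⌊n/3⌋ ∈ T` gives `⌊n/9⌋ ∈ T`, which `n ∉ 9T + 2` excludes
    have hT : n / 3 ∈ PartialStirling.T := by
      rcases hmem with ⟨-, h⟩ | ⟨-, -, h⟩ | ⟨h, -⟩
      · exact h
      · exact h
      · omega
    have h9 := ((PartialStirling.mem_T_iff _).1 hT).2
    rwa [Nat.div_div_eq_div_mul] at h9
  refine ⟨(PartialStirling.e_eq_s_iff hn).trans ⟨?_, fun hmem => ?_⟩, hfirst, hother⟩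
  · rintro ⟨j, hj, h⟩
    obtain ⟨hq, hS⟩ := PartialStirling.of_nu_a_eq_s hn hj h
    exact (PartialStirling.mem_union_iff n).2
      (PartialStirling.digits_of_stirlingSecond_ne_zero hn (Nat.div_le_div_right hj) hq hS)
  · by_cases h2 : n ∈ PartialStirling.affine 9 PartialStirling.T 2
    · exact ⟨n + 1, Nat.le_succ n, (hfirst h2).1⟩
    · exact ⟨n, le_rfl, hother hmem h2⟩
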